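/- All graphs are finite, simple and undirected, and $d$ is the distance between vertices. A packing $k$-coloring of a graph $G$ is a map $\Gamma:V(G)\to\{1,\dots,k\}$ such that any two distinct vertices of the same color $i$ are at distance at least $i+1$; the packing chromatic number $\chi_\rho(G)$ is the smallest $k$ for which $G$ has a packing $k$-coloring. A $(k,g)$-Moore graph is a $k$-regular graph of girth $g$ whose number of vertices is the Moore bound $n_0(k,g)$; for $g$ even, $n_0(k,g)=\frac{2(k-1)^{g/2}-2}{k-2}=2\sum_{i=0}^{g/2-1}(k-1)^i$ (so $n_0(q+1,8)=2(q+1)(q^2+1)$). For a finite field $F$ and a symbol $\rho\notin F$, let $Q_F$ be the bipartite graph with parts $V_0$ (points) and $V_1$ (lines), where $$V_i=\{(a,b,c)_i,\ (\rho,b,c)_i,\ (\rho,\rho,c)_i : a,b,c\in F\}\cup\{(\rho,\rho,\rho)_i\},$$ and with the following neighborhoods, for $a,b,c\in F$: $$N((a,b,c)_1)=\{(w,\,aw+b,\,a^2w+2ab+c)_0: w\in F\}\cup\{(\rho,a,c)_0\},$$ $$N((\rho,b,c)_1)=\{(c,b,w)_0: w\in F\}\cup\{(\rho,\rho,c)_0\},$$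 $$N((\rho,\rho,c)_1)=\{(\rho,c,w)_0: w\in F\}\cup\{(\rho,\rho,\rho)_0\},$$ $$N((\rho,\rho,\rho)_1)=\{(\rho,\rho,w)_0: w\in F\}\cup\{(\rho,\rho,\rho)_0\}.$$ **Theorem.** Let $q$ be an odd prime power and let $G$ be a $(q+1,8)$-Moore graph. Then $$(q^2+1)(q-1)+3\le\chi_\rho(G).$$ If moreover $G$ is isomorphic to the coordinatized incidence graph $Q_F$ for a field $F$ with $q$ elements, then also $$\chi_\rho(G)\le(q^2+1)(q-1)+4.$$ -/

import Mathlib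

/-- A packing `k`-coloring of `G`: a map `Γ : V → {1, …, k}` such that any two distinct vertices
of the same color `i` are at distance at least `i + 1`. The distance takes values in `ℕ∞`
and is `⊤` between different connected components. -/
def IsPackingColoring {V : Type*} (G : SimpleGraph V) (k : ℕ) (Γ : V → ℕ) : Prop :=
  (∀ v, 1 ≤ Γ v ∧ Γ v ≤ k) ∧
    ∀ u v, u ≠ v → Γ u = Γ v → ((Γ u + 1 : ℕ) : ℕ∞) ≤ G.edist u v

/-- The packing chromatic number: the smallest `k` for which `G` has a packing `k`-coloring. -/
noncomputable def packingChromaticNumber {V : Type*} (G : SimpleGraph V) : ℕ :=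
  sInf {k : ℕ | ∃ Γ : V → ℕ, IsPackingColoring G k Γ}

/-- On a finite graph the infimum is over a nonempty set, hence it is attained. -/
theorem exists_isPackingColoring_packingChromaticNumber {V : Type*} [Finite V]
    (G : SimpleGraph V) :
    ∃ Γ : V → ℕ, IsPackingColoring G (packingChromaticNumber G) Γ := by
  have h : {k : ℕ | ∃ Γ : V → ℕ, IsPackingColoring G k Γ}.Nonempty := by
    obtain ⟨n, ⟨e⟩⟩ := Finite.exists_equiv_fin V
    refine ⟨n, fun v => (e v : ℕ) + 1, fun v => ⟨Nat.succ_pos _, (e v).isLt⟩, ?_⟩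
    intro u v huv h
    exact absurd (e.injective (Fin.ext (by simpa using h))) huv
  exact Nat.sInf_mem h

/-- The Moore bound `n₀(k, g)`, the geometric sums being written out, so that `k = 2` needs
no special treatment. -/
def mooreBound (k g : ℕ) : ℕ :=
  if Even g then 2 * ∑ i ∈ Finset.range (g / 2), (k - 1) ^ i
  else 1 + k * ∑ i ∈ Finset.range ((g - 1) / 2), (k - 1) ^ i

/-- The closed form `n₀(k, g) = (2 (k - 1) ^ (g / 2) - 2) / (k - 2)` for even `g`, and
`n₀(k, g) = (k (k - 1) ^ ((g - 1) / 2) - 2) / (k - 2)` for odd `g`. -/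
theorem mooreBound_mul (k g : ℕ) (hk : 2 ≤ k) :
    (mooreBound k g : ℤ) * ((k : ℤ) - 2) =
      if Even g then 2 * ((k : ℤ) - 1) ^ (g / 2) - 2
      else (k : ℤ) * ((k : ℤ) - 1) ^ ((g - 1) / 2) - 2 := by
  have h1 : ((k - 1 : ℕ) : ℤ) = (k : ℤ) - 1 := by omega
  have geo (m : ℕ) := geom_sum_mul ((k : ℤ) - 1) m
  unfold mooreBound
  split_ifs with h
  · push_cast [h1]
    linear_combination 2 * geo (g / 2)
  · push_cast [h1]
    linear_combination (k : ℤ) * geo ((g - 1) / 2)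

/-- A `(k, g)`-Moore graph: a `k`-regular graph of girth `g` whose order is the Moore bound. -/
def IsMooreGraph {V : Type*} [Fintype V] (G : SimpleGraph V) [DecidableRel G.Adj]
    (k g : ℕ) : Prop :=
  G.IsRegularOfDegree k ∧ G.girth = g ∧ Fintype.card V = mooreBound k g

/-- The coordinates of a point or of a line of the quadrangle over `F`, with a symbol `ρ ∉ F`:
`aff a b c = (a, b, c)`, `rho₁ b c = (ρ, b, c)`, `rho₂ c = (ρ, ρ, c)`, `rho₃ = (ρ, ρ, ρ)`. -/
inductive GQCoord (F : Type*) where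
  | aff (a b c : F)
  | rho₁ (b c : F)
  | rho₂ (c : F)
  | rho₃

/-- `GQIncident x l`: the point with coordinates `x` lies on the line with coordinates `l`. -/
def GQIncident {F : Type*} [Field F] : GQCoord F → GQCoord F → Prop
  | .aff x y z, .aff a b c => y = a * x + b ∧ z = a ^ 2 * x + 2 * a * b + c
  | .rho₁ y z, .aff a _ c => y = a ∧ z = c
  | .aff x y _, .rho₁ b c => x = c ∧ y = b
  | .rho₂ z, .rho₁ _ c => z = c
  | .rho₁ y _, .rho₂ c => y = c
  | .rho₃, .rho₂ _ => True
  | .rho₂ _, .rho₃ => True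
  | .rho₃, .rho₃ => True
  | _, _ => False

/-- The incidence graph of the coordinatized generalized quadrangle over `F`: the vertices
`Sum.inl x` are the points, the vertices `Sum.inr l` are the lines. -/
def gqGraph (F : Type*) [Field F] : SimpleGraph (GQCoord F ⊕ GQCoord F) where
  Adj
    | .inl x, .inr l => GQIncident x l
    | .inr l, .inl x => GQIncident x l
    | _, _ => False
  symm := ⟨by rintro (x | x) (y | y) h <;> exact h⟩
  loopless := ⟨by rintro (x | x) h <;> exact h⟩

/-!
Put `n = (q + 1) * (q ^ 2 + 1)` and let `A` be the adjacency matrix. Girth `8` bounds the number of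
walks of length `3` between two vertices, and the Moore bound leaves no slack in these bounds: `G`
is bipartite with sides of size `n` and `A ^ 3 = 2 * q * A + B`, where `B` relates the vertices of
opposite sides. Hence `J + (q + 1) * (2 * q - A ^ 2)`, with `J` relating the vertices of the same
side, is a positive multiple of a projection. Its nonnegativity is an expander bound: a set that is
joined by many edges to a set `t` on one side is large.

Let `S` be an independent set and `P` a disjoint `2`-packing. If `t` is the part of `S` on the side
where `S` is smaller and `x` is the part of `P` on the other side, the expander bound still makes
the rest of that side, without `S` and `x`, at least as large as `t`. So `S` and `x` fit into `n`
vertices, and the part of `P` on the first side has at most `q ^ 2 + 1` vertices, a `2`-packing on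
one side having disjoint neighborhoods. A `3`-packing lies on one side, so that color `3` is also
used at most `q ^ 2 + 1` times, and the colors `i ≥ 4` at most once because the diameter is `4`.

For the upper bound, the lines get color `1` and two ovoids meeting only in `(ρ, ρ, ρ)` get the
colors `2` and `3`. All other vertices get their own color.
-/

open Finset SimpleGraph
open scoped Matrix

section Girth

variable {V : Type*} {G : SimpleGraph V} {u v : V}

theorem egirth_le_length_of_not_isAcyclic_fromEdgeSet {l : List (Sym2 V)}
    (hl : ∀ e ∈ l, e ∈ G.edgeSet) (h : ¬ (fromEdgeSet {e | e ∈ l}).IsAcyclic) :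
    G.egirth ≤ l.length := by
  have hle : fromEdgeSet {e | e ∈ l} ≤ G := by
    rw [← G.fromEdgeSet_edgeSet]
    exact fromEdgeSet_mono hl
  obtain ⟨a, c, hc, hlen⟩ := exists_egirth_eq_length.2 h
  have hsub : c.edges ⊆ l := fun e he =>
    (edgeSet_fromEdgeSet _ ▸ c.edges_subset_edgeSet he).1
  calc G.egirth ≤ (fromEdgeSet {e | e ∈ l}).egirth := egirth_anti hle
    _ = c.edges.length := by rw [hlen, c.length_edges]
    _ ≤ l.length := mod_cast (hc.edges_nodup.subperm hsub).length_le

theorem mem_edgeSet_fromEdgeSet_of_edges_subset {l : List (Sym2 V)} {p : G.Walk u v}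
    (hp : p.edges ⊆ l) : ∀ e ∈ p.edges, e ∈ (fromEdgeSet {e | e ∈ l}).edgeSet := fun e he => by
  rw [edgeSet_fromEdgeSet]
  exact ⟨hp he, G.not_isDiag_of_mem_edgeSet (p.edges_subset_edgeSet he)⟩

theorem egirth_le_length_of_odd {p : G.Walk u u} (hp : Odd p.length) :
    G.egirth ≤ p.length := by
  rw [← p.length_edges]
  refine egirth_le_length_of_not_isAcyclic_fromEdgeSet (fun _ he => p.edges_subset_edgeSet he)
    fun hac => Nat.not_even_iff_odd.2 hp ?_
  have hp' := mem_edgeSet_fromEdgeSet_of_edges_subset (List.Subset.refl p.edges)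
  simpa only [p.length_transfer] using
    two_colorable_iff_forall_loop_even.1 hac.colorable_two u (p.transfer _ hp')

theorem egirth_le_length_add_length {p p' : G.Walk u v} (hp : p.IsPath)
    (hp' : p'.IsPath) (hne : p ≠ p') : G.egirth ≤ ↑(p.length + p'.length) := by
  rw [← p.length_edges, ← p'.length_edges, ← List.length_append]
  refine egirth_le_length_of_not_isAcyclic_fromEdgeSet (fun e he => ?_) fun hac => hne ?_
  · rcases List.mem_append.1 he with h | h
    exacts [p.edges_subset_edgeSet h, p'.edges_subset_edgeSet h]
  · have h := mem_edgeSet_fromEdgeSet_of_edges_subset (List.subset_append_left p.edges p'.edges)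
    have h' := mem_edgeSet_fromEdgeSet_of_edges_subset (List.subset_append_right p.edges p'.edges)
    have hpath := (hac.subsingleton_path u v).elim ⟨p.transfer _ h, hp.transfer h⟩
      ⟨p'.transfer _ h', hp'.transfer h'⟩
    have hsupp := congrArg (fun r => r.1.support) hpath
    exact Walk.ext_support (by simpa only [Walk.support_transfer] using hsupp)

theorem IsMooreGraph.egirth_eq [Fintype V] [DecidableRel G.Adj] {k g : ℕ}
    (h : IsMooreGraph G k g) (hg : g ≠ 0) : G.egirth = g :=
  (ENat.toNat_eq_iff hg).1 h.2.1

end Girth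

section AdjMatrix

variable {V : Type*} [Fintype V] [DecidableEq V] {G : SimpleGraph V} [DecidableRel G.Adj] {k : ℕ}

theorem adjMatrix_pow_apply_ne_zero_iff {n : ℕ} {u v : V} :
    (G.adjMatrix ℤ ^ n) u v ≠ 0 ↔ ∃ p : G.Walk u v, p.length = n := by
  rw [adjMatrix_pow_apply_eq_card_walk, Nat.cast_ne_zero, ← Nat.pos_iff_ne_zero,
    Fintype.card_pos_iff]
  exact nonempty_subtype

theorem sum_adjMatrix_pow_apply (hk : G.IsRegularOfDegree k) (n : ℕ) (u : V) :
    ∑ v, (G.adjMatrix ℤ ^ n) u v = (k : ℤ) ^ n := by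
  induction n generalizing u with
  | zero => simp [Matrix.one_apply]
  | succ n ih =>
    simp only [pow_succ', adjMatrix_mul_apply]
    rw [sum_comm]
    simp [ih, hk.degree_eq u]

theorem adjMatrix_pow_apply_le_one {n : ℕ} {u v : V} (hg : ↑(2 * n) < G.egirth)
    (hpath : ∀ p : G.Walk u v, p.length = n → p.IsPath) : (G.adjMatrix ℤ ^ n) u v ≤ 1 := by
  rw [adjMatrix_pow_apply_eq_card_walk, Nat.cast_le_one, Fintype.card_le_one_iff_subsingleton]
  refine ⟨fun ⟨p, hp⟩ ⟨p', hp'⟩ => Subtype.ext ?_⟩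
  by_contra hne
  have hle := egirth_le_length_add_length (hpath p hp) (hpath p' hp') hne
  rw [hp, hp', ← two_mul] at hle
  exact hg.not_ge hle

theorem adjMatrix_sq_apply_le_one (hg : 4 < G.egirth) {u v : V} (huv : u ≠ v) :
    (G.adjMatrix ℤ ^ 2) u v ≤ 1 := by
  refine adjMatrix_pow_apply_le_one hg fun p hp => ?_
  match p, hp with
  | .cons h (.cons h' .nil), _ => simp [Walk.cons_isPath_iff, huv, h.ne, h'.ne]

theorem adjMatrix_sq_apply_self (hk : G.IsRegularOfDegree k) (u : V) :
    (G.adjMatrix ℤ ^ 2) u u = k := by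
  rw [sq, adjMatrix_mul_self_apply_self, hk.degree_eq u]

theorem adjMatrix_pow_three_apply_le_one (hg : 6 < G.egirth) {u v : V} (huv : ¬ G.Adj u v) :
    (G.adjMatrix ℤ ^ 3) u v ≤ 1 := by
  refine adjMatrix_pow_apply_le_one hg fun p hp => ?_
  have hne : u ≠ v := by
    rintro rfl
    have := egirth_le_length_of_odd (p := p) (hp ▸ by decide)
    rw [hp] at this
    exact absurd (hg.trans_le this) (by decide)
  match p, hp with
  | .cons (v := a) h (.cons (v := b) h' (.cons h'' .nil)), _ =>
    have hub : u ≠ b := fun e => huv (e ▸ h'')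
    have hav : a ≠ v := fun e => huv (e ▸ h)
    simp [Walk.cons_isPath_iff, h.ne, h'.ne, h''.ne, hub, hav, hne]

theorem adjMatrix_pow_three_apply_le_of_adj (hk : G.IsRegularOfDegree k) (hg : 4 < G.egirth)
    {u v : V} (huv : G.Adj u v) : (G.adjMatrix ℤ ^ 3) u v ≤ 2 * k - 1 := by
  have hv : v ∈ G.neighborFinset u := (mem_neighborFinset _ _ _).2 huv
  have hcard : (#((G.neighborFinset u).erase v) : ℤ) = k - 1 := by
    rw [card_erase_of_mem hv, card_neighborFinset_eq_degree, hk.degree_eq u,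
      Nat.cast_pred (hk.degree_eq u ▸ (G.degree_pos_iff_exists_adj u).2 ⟨v, huv⟩)]
  rw [pow_succ', adjMatrix_mul_apply, ← add_sum_erase _ _ hv, adjMatrix_sq_apply_self hk]
  have hle : ∑ a ∈ (G.neighborFinset u).erase v, (G.adjMatrix ℤ ^ 2) a v ≤ k - 1 := by
    rw [← hcard, ← mul_one (#_ : ℤ), ← nsmul_eq_mul]
    exact sum_le_card_nsmul _ _ _ fun a ha => adjMatrix_sq_apply_le_one hg (ne_of_mem_erase ha)
  linarith

end AdjMatrix

section Regular

variable {V : Type*} [Fintype V] {G : SimpleGraph V} [DecidableRel G.Adj] {k : ℕ}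

theorem sum_card_neighborFinset_inter_comm [DecidableEq V] (s t : Finset V) :
    ∑ v ∈ s, #(G.neighborFinset v ∩ t) = ∑ v ∈ t, #(G.neighborFinset v ∩ s) := by
  have h (u : V) (r : Finset V) : G.neighborFinset u ∩ r = {v ∈ r | G.Adj u v} := by
    ext; simp [and_comm]
  simp only [h]
  exact (sum_card_bipartiteAbove_eq_sum_card_bipartiteBelow G.Adj).trans
    (by simp only [bipartiteBelow, G.adj_comm])

theorem sum_card_neighborFinset_inter_eq [DecidableEq V] (hk : G.IsRegularOfDegree k)
    {s t : Finset V} (h : ∀ v ∈ t, G.neighborFinset v ⊆ s) :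
    ∑ v ∈ s, #(G.neighborFinset v ∩ t) = k * #t := by
  rw [sum_card_neighborFinset_inter_comm, sum_congr rfl fun v hv => by
    rw [inter_eq_left.2 (h v hv), card_neighborFinset_eq_degree, hk.degree_eq],
    sum_const, smul_eq_mul, mul_comm]

theorem card_le_card_of_neighborFinset_subset (hk : G.IsRegularOfDegree k) (hk₀ : k ≠ 0)
    {s t : Finset V} (h : ∀ v ∈ t, G.neighborFinset v ⊆ s) : #t ≤ #s := by
  classical
  refine Nat.le_of_mul_le_mul_left ?_ (Nat.pos_of_ne_zero hk₀)
  calc k * #t = ∑ v ∈ s, #(G.neighborFinset v ∩ t) := (sum_card_neighborFinset_inter_eq hk h).symm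
    _ ≤ ∑ v ∈ s, G.degree v := sum_le_sum fun _ _ => card_le_card inter_subset_left
    _ = k * #s := by simp only [hk.degree_eq, sum_const, smul_eq_mul, mul_comm]

theorem neighborFinset_subset_of_card_le_two_mul (hk : G.IsRegularOfDegree k) {s : Finset V}
    (hs : G.IsIndepSet s) (hcard : Fintype.card V ≤ 2 * #s) {v : V} (hv : v ∉ s) :
    G.neighborFinset v ⊆ s := by
  classical
  have hout : ∀ u ∈ s, #(G.neighborFinset u ∩ sᶜ) = k := fun u hu => by
    rw [inter_eq_left.2, card_neighborFinset_eq_degree, hk.degree_eq u]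
    intro w hw
    rw [mem_neighborFinset] at hw
    exact mem_compl.2 fun hws => hs hu hws hw.ne hw
  have hle : ∀ u ∈ sᶜ, #(G.neighborFinset u ∩ s) ≤ #(G.neighborFinset u) :=
    fun u _ => card_le_card inter_subset_left
  have hsum : ∑ u ∈ sᶜ, #(G.neighborFinset u) ≤ ∑ u ∈ sᶜ, #(G.neighborFinset u ∩ s) := by
    rw [sum_card_neighborFinset_inter_comm, sum_congr rfl hout]
    simp only [card_neighborFinset_eq_degree, hk.degree_eq, sum_const, smul_eq_mul, card_compl]
    exact Nat.mul_le_mul_right k (by lia)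
  have heq := (sum_eq_sum_iff_of_le hle).1 ((sum_le_sum hle).antisymm hsum) v (mem_compl.2 hv)
  exact inter_eq_left.1 (eq_of_subset_of_card_le inter_subset_left heq.ge)

theorem isBipartite_of_card_le_two_mul (hk : G.IsRegularOfDegree k) {s : Finset V}
    (hs : G.IsIndepSet s) (hcard : Fintype.card V ≤ 2 * #s) : G.IsBipartite := by
  classical
  refine IsBipartiteWith.isBipartite (s := s) (t := (sᶜ : Finset V))
    ⟨by simpa using disjoint_compl_right, fun u v huv => ?_⟩
  by_cases hu : u ∈ s
  · exact .inl ⟨hu, mem_compl.2 fun hv => hs hu hv huv.ne huv⟩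
  · exact .inr ⟨mem_compl.2 hu, neighborFinset_subset_of_card_le_two_mul hk hs hcard hu
      ((mem_neighborFinset _ _ _).2 huv)⟩

theorem two_mul_card_coloring_eq (hk : G.IsRegularOfDegree k) (hk₀ : k ≠ 0) (c : G.Coloring Bool)
    (b : Bool) : 2 * #{v | c v = b} = Fintype.card V := by
  have hsum : ∑ v with c v = b, G.degree v = ∑ v with c v = !b, G.degree v := by
    refine isBipartiteWith_sum_degrees_eq ⟨?_, fun u v huv => ?_⟩
    · rw [disjoint_coe]
      exact disjoint_filter.2 fun v _ h => by simp [h]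
    · have := c.valid huv
      cases b <;> cases hu : c u <;> cases hv : c v <;> simp_all
  simp only [hk.degree_eq, sum_const, smul_eq_mul, mul_left_inj' hk₀] at hsum
  have := card_filter_add_card_filter_not (s := (univ : Finset V)) (c · = b)
  simp only [Bool.eq_not, card_univ] at *
  lia

end Regular

section Moore

variable {V : Type*} [Fintype V] {G : SimpleGraph V} [DecidableRel G.Adj] {q : ℕ}

theorem IsMooreGraph.card_eq (hG : IsMooreGraph G (q + 1) 8) :
    Fintype.card V = 2 * ((q + 1) * (q ^ 2 + 1)) := by
  rw [hG.2.2]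
  simp only [mooreBound, show Even 8 by decide, if_true, Nat.add_sub_cancel, Nat.reduceDiv,
    sum_range_succ, sum_range_zero]
  ring

theorem IsMooreGraph.lt_egirth (hG : IsMooreGraph G (q + 1) 8) {n : ℕ} (hn : n < 8) :
    n < G.egirth := by
  rw [hG.egirth_eq (by decide)]
  exact_mod_cast hn

theorem IsMooreGraph.adjMatrix_pow_three_apply_le [DecidableEq V] (hG : IsMooreGraph G (q + 1) 8)
    (u v : V) : (G.adjMatrix ℤ ^ 3) u v ≤ 2 * q * G.adjMatrix ℤ u v + 1 := by
  rw [adjMatrix_apply]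
  split_ifs with huv
  · have := adjMatrix_pow_three_apply_le_of_adj hG.1 (hG.lt_egirth (n := 4) (by decide)) huv
    push_cast at this
    linarith
  · simpa using adjMatrix_pow_three_apply_le_one (hG.lt_egirth (n := 6) (by decide)) huv

theorem sum_adjMatrix_apply {k : ℕ} (hk : G.IsRegularOfDegree k) (u : V) :
    ∑ v, G.adjMatrix ℤ u v = k := by
  classical simpa only [pow_one] using sum_adjMatrix_pow_apply hk 1 u

theorem IsMooreGraph.card_le_card_pow_three_ne_zero [DecidableEq V]
    (hG : IsMooreGraph G (q + 1) 8) (u : V) :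
    (q + 1) * (q ^ 2 + 1) ≤ #{v | (G.adjMatrix ℤ ^ 3) u v ≠ 0} := by
  have hle (v : V) : (G.adjMatrix ℤ ^ 3) u v ≤
      2 * q * G.adjMatrix ℤ u v + if (G.adjMatrix ℤ ^ 3) u v ≠ 0 then 1 else 0 := by
    split_ifs with h
    · exact hG.adjMatrix_pow_three_apply_le u v
    · rw [not_not.1 h, adjMatrix_apply]
      positivity
  have hsum := sum_le_sum fun v (_ : v ∈ univ) => hle v
  rw [sum_adjMatrix_pow_apply hG.1, sum_add_distrib, ← mul_sum, sum_adjMatrix_apply hG.1,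
    sum_boole] at hsum
  zify
  push_cast at hsum
  linarith

theorem IsMooreGraph.isBipartite (hG : IsMooreGraph G (q + 1) 8) : G.IsBipartite := by
  classical
  have hpos : 0 < Fintype.card V := hG.card_eq ▸ by positivity
  obtain ⟨u⟩ := Fintype.card_pos_iff.1 hpos
  refine isBipartite_of_card_le_two_mul hG.1 (s := {v | (G.adjMatrix ℤ ^ 3) u v ≠ 0}) ?_
    (hG.card_eq.trans_le (Nat.mul_le_mul_left 2 (hG.card_le_card_pow_three_ne_zero u)))
  intro v hv w hw _ hvw
  rw [mem_coe, mem_filter_univ, adjMatrix_pow_apply_ne_zero_iff] at hv hw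
  obtain ⟨p, hp⟩ := hv
  obtain ⟨p', hp'⟩ := hw
  have hlen : ((p.concat hvw).append p'.reverse).length = 7 := by simp [hp, hp']
  have hle := egirth_le_length_of_odd (p := (p.concat hvw).append p'.reverse) (hlen ▸ by decide)
  exact (hG.lt_egirth (by decide)).not_ge (hlen ▸ hle)

theorem IsMooreGraph.nonempty_coloring_bool (hG : IsMooreGraph G (q + 1) 8) :
    Nonempty (G.Coloring Bool) :=
  let ⟨c⟩ := hG.isBipartite
  ⟨G.recolorOfEquiv finTwoEquiv c⟩

theorem IsMooreGraph.card_coloring_eq (hG : IsMooreGraph G (q + 1) 8) (c : G.Coloring Bool)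
    (b : Bool) : #{v | c v = b} = (q + 1) * (q ^ 2 + 1) := by
  have := two_mul_card_coloring_eq hG.1 q.succ_ne_zero c b
  rw [hG.card_eq] at this
  lia

end Moore

section QuadraticForm

theorem dotProduct_mulVec_nonneg_of_mul_self_eq_smul {n R : Type*} [Fintype n] [CommRing R]
    [LinearOrder R] [IsStrictOrderedRing R] {M : Matrix n n R} (hM : M.IsSymm) {a : R}
    (ha : 0 < a) (hMM : M * M = a • M) (x : n → R) : 0 ≤ x ⬝ᵥ M *ᵥ x := by
  have hsq : M *ᵥ x ⬝ᵥ M *ᵥ x = a * (x ⬝ᵥ M *ᵥ x) := by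
    rw [Matrix.dotProduct_mulVec, ← Matrix.mulVec_transpose, hM.eq, Matrix.mulVec_mulVec, hMM,
      Matrix.smul_mulVec, smul_dotProduct, smul_eq_mul, dotProduct_comm]
  have hnonneg : 0 ≤ M *ᵥ x ⬝ᵥ M *ᵥ x := sum_nonneg fun i _ => mul_self_nonneg _
  exact nonneg_of_mul_nonneg_right (hsq ▸ hnonneg) ha

end QuadraticForm

section Coloring

variable {V : Type*}

/-- The matrix of the relation "same color". If both colors of `c` occur `m` times, it is `m` times
the projection onto the functions that are constant on the color classes. -/
def sameColorMatrix (c : V → Bool) : Matrix V V ℤ :=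
  Matrix.of fun u v => if c u = c v then 1 else 0

theorem sameColorMatrix_apply (c : V → Bool) (u v : V) :
    sameColorMatrix c u v = if c u = c v then 1 else 0 :=
  rfl

theorem isSymm_sameColorMatrix (c : V → Bool) : (sameColorMatrix c).IsSymm :=
  Matrix.IsSymm.ext fun u v => by simp only [sameColorMatrix_apply, eq_comm]

variable [Fintype V]

theorem sameColorMatrix_mul_self {c : V → Bool} {m : ℕ} (hc : ∀ b, #{v | c v = b} = m) :
    sameColorMatrix c * sameColorMatrix c = (m : ℤ) • sameColorMatrix c := by
  ext u v
  have h (w : V) : sameColorMatrix c u w * sameColorMatrix c w v =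
      if c w = c u then sameColorMatrix c u v else 0 := by
    by_cases huw : c w = c u
    · simp [sameColorMatrix_apply, huw]
    · simp [sameColorMatrix_apply, huw, Ne.symm huw]
  simp only [Matrix.mul_apply, h, ← sum_filter, sum_const, hc, Matrix.smul_apply, nsmul_eq_mul,
    smul_eq_mul]

variable {G : SimpleGraph V} [DecidableRel G.Adj] {k : ℕ}

theorem adjMatrix_sq_mul_sameColorMatrix [DecidableEq V] (hk : G.IsRegularOfDegree k)
    (c : G.Coloring Bool) :
    G.adjMatrix ℤ ^ 2 * sameColorMatrix c = (k : ℤ) ^ 2 • sameColorMatrix c := by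
  ext u v
  have h : ∀ w ∈ G.neighborFinset u, ∀ x ∈ G.neighborFinset w,
      sameColorMatrix c x v = sameColorMatrix c u v := fun w hw x hx => by
    rw [mem_neighborFinset] at hw hx
    have hux : c u = c x := by simpa using c.even_length_iff_congr (.cons hw (.cons hx .nil))
    simp only [sameColorMatrix_apply, hux]
  rw [sq, Matrix.mul_assoc, adjMatrix_mul_apply]
  simp only [adjMatrix_mul_apply]
  rw [sum_congr rfl fun w hw => sum_congr rfl (h w hw)]
  simp [hk.degree_eq, sq, mul_assoc]

end Coloring

section Spectral

variable {V : Type*} [Fintype V] {G : SimpleGraph V} [DecidableRel G.Adj] {q : ℕ}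

theorem IsMooreGraph.adjMatrix_pow_three_apply [DecidableEq V] (hG : IsMooreGraph G (q + 1) 8)
    (c : G.Coloring Bool) (u v : V) :
    (G.adjMatrix ℤ ^ 3) u v = 2 * q * G.adjMatrix ℤ u v + if c u = c v then 0 else 1 := by
  have hle : ∀ v ∈ univ, (G.adjMatrix ℤ ^ 3) u v ≤
      2 * q * G.adjMatrix ℤ u v + if c u = c v then 0 else 1 := fun v _ => by
    split_ifs with huv
    · have hodd : (G.adjMatrix ℤ ^ 3) u v = 0 := by
        by_contra hne
        obtain ⟨p, hp⟩ := adjMatrix_pow_apply_ne_zero_iff.1 hne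
        have := (c.odd_length_iff_not_congr p).1 (hp ▸ by decide)
        simp [huv] at this
      rw [hodd, adjMatrix_apply]
      positivity
    · exact hG.adjMatrix_pow_three_apply_le u v
  have hcard : ∑ v, (if c u = c v then 0 else 1 : ℤ) = (q + 1) * (q ^ 2 + 1) := by
    rw [sum_ite, sum_const_zero, zero_add, sum_const, nsmul_one]
    exact_mod_cast (by simpa only [Bool.eq_not, ne_comm (b := c u)] using
      hG.card_coloring_eq c (!c u))
  refine (sum_eq_sum_iff_of_le hle).1 ?_ v (mem_univ v)
  rw [sum_adjMatrix_pow_apply hG.1, sum_add_distrib, ← mul_sum, sum_adjMatrix_apply hG.1, hcard]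
  push_cast
  ring

theorem IsMooreGraph.adjMatrix_pow_four [DecidableEq V] (hG : IsMooreGraph G (q + 1) 8)
    (c : G.Coloring Bool) :
    G.adjMatrix ℤ ^ 4 =
      (2 * q : ℤ) • G.adjMatrix ℤ ^ 2 + ((q : ℤ) + 1) • sameColorMatrix c := by
  ext u v
  have hcolor : ∀ w ∈ G.neighborFinset u, (if c w = c v then 0 else 1 : ℤ) =
      sameColorMatrix c u v := fun w hw => by
    have := c.valid ((mem_neighborFinset _ _ _).1 hw)
    rw [sameColorMatrix_apply]
    cases hw : c w <;> cases hu : c u <;> cases hv : c v <;> simp_all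
  rw [pow_succ', adjMatrix_mul_apply]
  simp only [hG.adjMatrix_pow_three_apply c, sum_add_distrib, ← mul_sum]
  rw [sum_congr rfl hcolor, ← adjMatrix_mul_apply, ← sq, sum_const, card_neighborFinset_eq_degree,
    hG.1.degree_eq, Matrix.add_apply, Matrix.smul_apply, Matrix.smul_apply, nsmul_eq_mul,
    smul_eq_mul, smul_eq_mul, Nat.cast_succ]

/-- For a `(q + 1, 8)`-Moore graph `G` with two-coloring `c`, this is `2 * q * (q + 1)` times the
orthogonal projection onto the kernel of the adjacency matrix: the other eigenvalues of
`G.adjMatrix ℤ ^ 2` are `2 * q`, and `(q + 1) ^ 2` on the functions constant on both sides. -/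
def kernelMatrix [DecidableEq V] (G : SimpleGraph V) [DecidableRel G.Adj] (c : V → Bool)
    (q : ℕ) : Matrix V V ℤ :=
  sameColorMatrix c + ((q : ℤ) + 1) • ((2 * q : ℤ) • 1 - G.adjMatrix ℤ ^ 2)

theorem isSymm_kernelMatrix [DecidableEq V] (c : V → Bool) : (kernelMatrix G c q).IsSymm :=
  (isSymm_sameColorMatrix c).add
    (((Matrix.isSymm_one.smul _).sub ((isSymm_adjMatrix G).pow 2)).smul _)

theorem IsMooreGraph.kernelMatrix_mul_self [DecidableEq V] (hG : IsMooreGraph G (q + 1) 8)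
    (c : G.Coloring Bool) :
    kernelMatrix G c q * kernelMatrix G c q = (2 * q * (q + 1) : ℤ) • kernelMatrix G c q := by
  have hAJ := adjMatrix_sq_mul_sameColorMatrix hG.1 c
  have hJA : sameColorMatrix c * G.adjMatrix ℤ ^ 2 =
      ((q + 1 : ℕ) : ℤ) ^ 2 • sameColorMatrix c := by
    simpa only [Matrix.transpose_mul, Matrix.transpose_smul, Matrix.transpose_pow,
      (isSymm_sameColorMatrix c).eq, transpose_adjMatrix] using congrArg Matrix.transpose hAJ
  have hJJ := sameColorMatrix_mul_self (hG.card_coloring_eq c)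
  have hAA : G.adjMatrix ℤ ^ 2 * G.adjMatrix ℤ ^ 2 = _ :=
    (pow_add _ 2 2).symm.trans (hG.adjMatrix_pow_four c)
  simp only [kernelMatrix, add_mul, mul_add, sub_mul, mul_sub, smul_mul_assoc, mul_smul_comm,
    one_mul, mul_one, hAJ, hJA, hJJ, hAA]
  push_cast
  module

theorem ite_mem_dotProduct [DecidableEq V] (s : Finset V) (f : V → ℤ) :
    (fun v => if v ∈ s then 1 else 0) ⬝ᵥ f = ∑ v ∈ s, f v := by
  simp [dotProduct, ite_mul, sum_ite_mem]

theorem IsMooreGraph.sum_sq_card_neighborFinset_inter_le [DecidableEq V]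
    (hG : IsMooreGraph G (q + 1) 8) (hq : 0 < q) (c : G.Coloring Bool) {b : Bool} {t : Finset V}
    (ht : ∀ v ∈ t, c v = b) :
    (q + 1) * ∑ v, #(G.neighborFinset v ∩ t) ^ 2 ≤ #t * (2 * q * (q + 1) + #t) := by
  set x : V → ℤ := fun v => if v ∈ t then 1 else 0 with hx
  have hAx : G.adjMatrix ℤ *ᵥ x = fun v => (#(G.neighborFinset v ∩ t) : ℤ) := by
    ext v
    rw [adjMatrix_mulVec_apply, hx, sum_boole, filter_mem_eq_inter]
  have hxx : x ⬝ᵥ x = #t := by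
    rw [hx, ite_mem_dotProduct]
    simp [sum_ite_mem]
  have hxJx : x ⬝ᵥ sameColorMatrix c *ᵥ x = (#t : ℤ) ^ 2 := by
    have h : ∀ v ∈ t, (sameColorMatrix c *ᵥ x) v = #t := fun v hv => by
      rw [Matrix.mulVec, dotProduct_comm, hx, ite_mem_dotProduct,
        sum_congr rfl fun w hw => by rw [sameColorMatrix_apply, ht v hv, ht w hw, if_pos rfl]]
      simp
    rw [hx, ite_mem_dotProduct, sum_congr rfl h, sum_const, nsmul_eq_mul, sq]
  have hxAAx : x ⬝ᵥ (G.adjMatrix ℤ ^ 2) *ᵥ x = ∑ v, (#(G.neighborFinset v ∩ t) : ℤ) ^ 2 := by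
    rw [sq, ← Matrix.mulVec_mulVec, Matrix.dotProduct_mulVec, ← Matrix.mulVec_transpose,
      transpose_adjMatrix, hAx]
    simp only [dotProduct, sq]
  have hnonneg := dotProduct_mulVec_nonneg_of_mul_self_eq_smul (isSymm_kernelMatrix c)
    (by positivity) (hG.kernelMatrix_mul_self c) x
  simp only [kernelMatrix, Matrix.add_mulVec, Matrix.smul_mulVec, Matrix.sub_mulVec,
    Matrix.one_mulVec, dotProduct_add, dotProduct_sub, dotProduct_smul, smul_eq_mul, hxx, hxJx,
    hxAAx] at hnonneg
  zify
  linarith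

theorem IsMooreGraph.mul_sq_mul_card_le [DecidableEq V] (hG : IsMooreGraph G (q + 1) 8)
    (hq : 0 < q) (c : G.Coloring Bool) {b : Bool} {s t : Finset V} (ht : ∀ v ∈ t, c v = b) {m : ℕ}
    (hm : m * #t ≤ ∑ v ∈ s, #(G.neighborFinset v ∩ t)) :
    (q + 1) * m ^ 2 * #t ≤ #s * (2 * q * (q + 1) + #t) := by
  obtain h₀ | hpos := Nat.eq_zero_or_pos #t
  · simp [h₀]
  refine Nat.le_of_mul_le_mul_right ?_ hpos
  calc (q + 1) * m ^ 2 * #t * #t = (q + 1) * (m * #t) ^ 2 := by ring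
    _ ≤ (q + 1) * (∑ v ∈ s, #(G.neighborFinset v ∩ t)) ^ 2 := by gcongr
    _ ≤ (q + 1) * (#s * ∑ v ∈ s, #(G.neighborFinset v ∩ t) ^ 2) := by
      gcongr; exact sq_sum_le_card_mul_sum_sq
    _ ≤ #s * ((q + 1) * ∑ v, #(G.neighborFinset v ∩ t) ^ 2) := by
      rw [mul_left_comm]
      gcongr
      exact subset_univ s
    _ ≤ #s * (#t * (2 * q * (q + 1) + #t)) :=
      Nat.mul_le_mul_left _ (hG.sum_sq_card_neighborFinset_inter_le hq c ht)
    _ = #s * (2 * q * (q + 1) + #t) * #t := by ring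

end Spectral

section Arithmetic

theorem lt_of_mul_sq_mul_le {q t w : ℤ} (hq : 0 < q) (ht : 0 ≤ t) (hwt : w < t)
    (h : (q + 1) * q ^ 2 * t ≤ w * (2 * q * (q + 1) + t)) : q * (q + 1) * (q - 2) < t := by
  have hw : w * (2 * q * (q + 1) + t) ≤ (t - 1) * (2 * q * (q + 1) + t) := by gcongr; lia
  by_contra! hle
  linarith [mul_le_mul_of_nonneg_left hle ht, mul_pos hq (by linarith : 0 < q + 1)]

theorem le_of_expansion_bounds {q t w x : ℤ} (hq : 3 ≤ q) (ht : 0 ≤ t) (hx : x ≤ q ^ 2 + 1)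
    (htn : 2 * t ≤ (q + 1) * (q ^ 2 + 1))
    (hs : (q + 1) * (q + 1) ^ 2 * t ≤ (w + x) * (2 * q * (q + 1) + t))
    (hw : (q + 1) * q ^ 2 * t ≤ w * (2 * q * (q + 1) + t)) : t ≤ w := by
  by_contra! hwt
  have hlow := lt_of_mul_sq_mul_le (by lia) ht hwt hw
  have hquad : 0 ≤ t ^ 2 - (q ^ 3 + q + 1) * t + 2 * q ^ 3 * (q + 1) := by
    have : (w + x) * (2 * q * (q + 1) + t) ≤ (t + q ^ 2) * (2 * q * (q + 1) + t) :=
      mul_le_mul_of_nonneg_right (by linarith) (by positivity)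
    linarith
  -- The quadratic in `hquad` is convex, but it is negative at both ends of the interval
  -- `[q * (q + 1) * (q - 2), (q + 1) * (q ^ 2 + 1) / 2]` that contains `t`.
  have hconvex : 0 ≤ (t - q * (q + 1) * (q - 2)) * ((q + 1) * (q ^ 2 + 1) - 2 * t) :=
    mul_nonneg (by linarith) (by linarith)
  have hslope : 0 ≤ q ^ 3 - q ^ 2 - 5 * q - 1 := by
    obtain ⟨m, rfl⟩ := Int.exists_add_of_le hq
    ring_nf
    positivity
  have hendpoint : 0 < (q + 1) * (q ^ 5 - q ^ 4 - 6 * q ^ 3 + q + 1) := by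
    obtain ⟨m, rfl⟩ := Int.exists_add_of_le hq
    ring_nf
    positivity
  linarith [mul_le_mul_of_nonneg_left htn hslope]

end Arithmetic

section Packing

variable {V : Type*} {G : SimpleGraph V} {i j : ℕ} {s t : Set V}

/-- An `i`-packing: a set of vertices at pairwise distance greater than `i`. These are the possible
color classes of color `i` of a packing coloring. -/
def IsPacking (G : SimpleGraph V) (i : ℕ) (s : Set V) : Prop :=
  s.Pairwise fun u v => (i : ℕ∞) < G.edist u v

theorem isPackingColoring_iff {k : ℕ} {Γ : V → ℕ} :
    IsPackingColoring G k Γ ↔ (∀ v, 1 ≤ Γ v ∧ Γ v ≤ k) ∧ ∀ i, IsPacking G i {v | Γ v = i} := by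
  refine and_congr_right fun _ => ⟨fun h i u hu v hv huv => ?_, fun h u v huv hΓ => ?_⟩
  · have := h u v huv (hu.trans hv.symm)
    rw [Set.mem_ofPred.1 hu, Nat.cast_succ] at this
    exact (ENat.add_one_le_iff (ENat.natCast_ne_top i)).1 this
  · rw [Nat.cast_succ]
    exact Order.add_one_le_of_lt (h (Γ u) rfl hΓ.symm huv)

theorem isPacking_one_iff : IsPacking G 1 s ↔ G.IsIndepSet s := by
  refine forall₄_congr fun u _ v _ => imp_congr_right fun huv => ?_
  simp only [Nat.cast_one, ← edist_eq_one_iff_adj]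
  exact (Order.one_le_iff_pos.2 (edist_pos_of_ne huv)).lt_iff_ne'

theorem isPacking_three_of_coloring (c : G.Coloring Bool) {b : Bool} (hs : ∀ v ∈ s, c v = b)
    (h : ∀ u ∈ s, ∀ v ∈ s, ∀ w, G.Adj u w → G.Adj v w → u = v) : IsPacking G 3 s := by
  intro u hu v hv huv
  have hcol : c u = c v := (hs u hu).trans (hs v hv).symm
  have htwo : 2 < G.edist u v := two_lt_edist_iff.2
    ⟨huv, fun hadj => c.valid hadj hcol, Set.eq_empty_of_forall_notMem fun w hw =>
      huv (h u hu v hv w hw.1 hw.2)⟩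
  refine lt_of_le_of_ne (Order.add_one_le_of_lt htwo) fun heq => ?_
  obtain ⟨p, hp⟩ := exists_walk_of_edist_eq_coe heq.symm
  exact absurd ((c.even_length_iff_congr p).2 (by rw [hcol])) (by rw [hp]; decide)

namespace IsPacking

theorem subset (h : IsPacking G i t) (hst : s ⊆ t) : IsPacking G i s :=
  Set.Pairwise.mono hst h

theorem of_le (h : IsPacking G j s) (hij : i ≤ j) : IsPacking G i s :=
  Set.Pairwise.mono' (fun _ _ => lt_of_le_of_lt (Nat.cast_le.2 hij)) h

theorem eq_of_adj_of_adj (h : IsPacking G 2 s) {u v w : V} (hu : u ∈ s) (hv : v ∈ s)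
    (hwu : G.Adj w u) (hwv : G.Adj w v) : u = v := by
  by_contra huv
  have hle := edist_le (.cons hwu.symm (.cons hwv .nil))
  exact (h hu hv huv).not_ge hle

theorem card_neighborFinset_inter_le_one [Fintype V] [DecidableEq V] [DecidableRel G.Adj]
    {s : Finset V} (h : IsPacking G 2 (s : Set V)) (v : V) : #(G.neighborFinset v ∩ s) ≤ 1 := by
  refine card_le_one.2 fun u hu w hw => ?_
  rw [mem_inter, mem_neighborFinset] at hu hw
  exact h.eq_of_adj_of_adj hu.2 hw.2 hu.1 hw.1

end IsPacking

end Packing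

section MoorePacking

variable {V : Type*} [Fintype V] {G : SimpleGraph V} [DecidableRel G.Adj] {q : ℕ}

theorem neighborFinset_subset_filter_coloring (c : G.Coloring Bool) {b : Bool} {v : V}
    (hv : c v = b) : G.neighborFinset v ⊆ ({w | c w = !b} : Finset V) := fun w hw => by
  have := c.valid ((mem_neighborFinset _ _ _).1 hw)
  rw [mem_filter_univ, ← hv, Bool.eq_not]
  exact this.symm

theorem IsMooreGraph.card_le_of_isPacking_two (hG : IsMooreGraph G (q + 1) 8) (c : G.Coloring Bool)
    {b : Bool} {s : Finset V} (hs : IsPacking G 2 (s : Set V)) (hb : ∀ v ∈ s, c v = b) :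
    #s ≤ q ^ 2 + 1 := by
  classical
  refine Nat.le_of_mul_le_mul_left ?_ q.succ_pos
  calc (q + 1) * #s = ∑ w with c w = !b, #(G.neighborFinset w ∩ s) :=
        (sum_card_neighborFinset_inter_eq hG.1 fun v hv =>
          neighborFinset_subset_filter_coloring c (hb v hv)).symm
    _ ≤ ∑ w with c w = !b, 1 := sum_le_sum fun w _ => hs.card_neighborFinset_inter_le_one w
    _ = (q + 1) * (q ^ 2 + 1) := by rw [← card_eq_sum_ones, hG.card_coloring_eq c]

theorem IsMooreGraph.edist_le_three (hG : IsMooreGraph G (q + 1) 8) (c : G.Coloring Bool) {u v : V}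
    (huv : c u ≠ c v) : G.edist u v ≤ 3 := by
  classical
  have hne : (G.adjMatrix ℤ ^ 3) u v ≠ 0 := by
    rw [hG.adjMatrix_pow_three_apply c, if_neg huv, adjMatrix_apply]
    positivity
  obtain ⟨p, hp⟩ := adjMatrix_pow_apply_ne_zero_iff.1 hne
  exact_mod_cast hp ▸ edist_le p

theorem IsMooreGraph.edist_le_four (hG : IsMooreGraph G (q + 1) 8) (u v : V) :
    G.edist u v ≤ 4 := by
  obtain ⟨c⟩ := hG.nonempty_coloring_bool
  by_cases huv : c u = c v
  · obtain ⟨w, huw⟩ := (G.degree_pos_iff_exists_adj u).1 (hG.1.degree_eq u ▸ q.succ_pos)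
    calc G.edist u v ≤ G.edist u w + G.edist w v := G.edist_triangle
      _ ≤ 1 + 3 := add_le_add (edist_eq_one_iff_adj.2 huw).le
        (hG.edist_le_three c (huv ▸ (c.valid huw).symm))
      _ = 4 := by norm_num
  · exact (hG.edist_le_three c huv).trans (by decide)

theorem IsMooreGraph.card_le_of_isPacking_three (hG : IsMooreGraph G (q + 1) 8) {s : Finset V}
    (hs : IsPacking G 3 (s : Set V)) : #s ≤ q ^ 2 + 1 := by
  obtain ⟨c⟩ := hG.nonempty_coloring_bool
  obtain rfl | ⟨u, hu⟩ := s.eq_empty_or_nonempty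
  · exact Nat.zero_le _
  refine hG.card_le_of_isPacking_two c (b := c u) (hs.of_le (by decide)) fun v hv => ?_
  by_contra hvu
  exact (hs hv hu (ne_of_apply_ne c hvu)).not_ge (hG.edist_le_three c hvu)

theorem IsMooreGraph.card_le_card_sdiff [DecidableEq V] (hG : IsMooreGraph G (q + 1) 8) (hq : 3 ≤ q)
    (c : G.Coloring Bool) {b : Bool} {s t x : Finset V} (ht : ∀ v ∈ t, c v = b)
    (hts : ∀ v ∈ t, G.neighborFinset v ⊆ s) (hx : IsPacking G 2 (x : Set V)) (hxs : x ⊆ s)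
    (hxb : ∀ v ∈ x, c v = !b) (htn : 2 * #t ≤ (q + 1) * (q ^ 2 + 1)) : #t ≤ #(s \ x) := by
  have hs_sum := sum_card_neighborFinset_inter_eq hG.1 hts
  have hx_sum : ∑ v ∈ x, #(G.neighborFinset v ∩ t) ≤ #t := by
    rw [sum_card_neighborFinset_inter_comm, card_eq_sum_ones]
    exact sum_le_sum fun v _ => hx.card_neighborFinset_inter_le_one v
  have hsdiff_sum : q * #t ≤ ∑ v ∈ s \ x, #(G.neighborFinset v ∩ t) := by
    have := sum_sdiff (f := fun v => #(G.neighborFinset v ∩ t)) hxs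
    lia
  have hs := hG.mul_sq_mul_card_le (by lia) c ht hs_sum.ge
  have hw := hG.mul_sq_mul_card_le (by lia) c ht hsdiff_sum
  rw [← card_sdiff_add_card_eq_card hxs] at hs
  zify at *
  exact le_of_expansion_bounds hq (by positivity)
    (mod_cast hG.card_le_of_isPacking_two c hx hxb) htn hs hw

theorem IsMooreGraph.card_add_card_le_of_card_filter_le (hG : IsMooreGraph G (q + 1) 8)
    (hq : 3 ≤ q) (c : G.Coloring Bool) {A B : Finset V} (hA : G.IsIndepSet A)
    (hB : IsPacking G 2 (B : Set V)) (hAB : Disjoint A B) {b : Bool}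
    (hb : #{v ∈ A | c v = b} ≤ #{v ∈ A | c v = !b}) :
    #A + #B ≤ (q + 1) * (q ^ 2 + 1) + (q ^ 2 + 1) := by
  classical
  have split (s : Finset V) : #{v ∈ s | c v = b} + #{v ∈ s | c v = !b} = #s := by
    simpa only [Bool.eq_not] using card_filter_add_card_filter_not (s := s) (c · = b)
  have hside : #(({v | c v = !b} : Finset V) \ A) + #{v ∈ A | c v = !b} =
      (q + 1) * (q ^ 2 + 1) := by
    simpa only [filter_inter, univ_inter, hG.card_coloring_eq c] using
      card_sdiff_add_card_inter ({v | c v = !b} : Finset V) A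
  have hBA : {v ∈ B | c v = !b} ⊆ ({v | c v = !b} : Finset V) \ A := fun v hv => by
    rw [mem_filter] at hv
    exact mem_sdiff.2 ⟨mem_filter_univ _ |>.2 hv.2, fun hvA => disjoint_left.1 hAB hvA hv.1⟩
  have hnbr : ∀ v ∈ A, c v = b → G.neighborFinset v ⊆ ({v | c v = !b} : Finset V) \ A :=
    fun v hv hvb w hw => mem_sdiff.2 ⟨neighborFinset_subset_filter_coloring c hvb hw, fun hwA =>
      have hvw := (mem_neighborFinset _ _ _).1 hw
      hA hv hwA hvw.ne hvw⟩
  have hnbr' : ∀ v ∈ {v ∈ A | c v = b}, G.neighborFinset v ⊆ ({v | c v = !b} : Finset V) \ A :=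
    fun v hv => hnbr v (mem_filter.1 hv).1 (mem_filter.1 hv).2
  have hhall := card_le_card_of_neighborFinset_subset hG.1 q.succ_ne_zero hnbr'
  have hle := hG.card_le_card_sdiff hq c (fun v hv => (mem_filter.1 hv).2) hnbr'
    (hB.subset (mod_cast filter_subset _ _)) hBA (fun v hv => (mem_filter.1 hv).2) (by lia)
  have hBb := hG.card_le_of_isPacking_two c (s := {v ∈ B | c v = b}) (b := b)
    (hB.subset (mod_cast filter_subset _ _)) fun v hv => (mem_filter.1 hv).2
  have := card_sdiff_add_card_eq_card hBA
  have := split A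
  have := split B
  lia

theorem IsMooreGraph.card_add_card_le (hG : IsMooreGraph G (q + 1) 8) (hq : 3 ≤ q)
    {A B : Finset V} (hA : IsPacking G 1 (A : Set V)) (hB : IsPacking G 2 (B : Set V))
    (hAB : Disjoint A B) : #A + #B ≤ (q + 1) * (q ^ 2 + 1) + (q ^ 2 + 1) := by
  rw [isPacking_one_iff] at hA
  obtain ⟨c⟩ := hG.nonempty_coloring_bool
  obtain hle | hle := le_total #{v ∈ A | c v = false} #{v ∈ A | c v = true}
  · exact hG.card_add_card_le_of_card_filter_le hq c hA hB hAB (b := false) hle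
  · exact hG.card_add_card_le_of_card_filter_le hq c hA hB hAB (b := true) hle

theorem IsMooreGraph.injOn_of_isPackingColoring (hG : IsMooreGraph G (q + 1) 8) {k : ℕ} {Γ : V → ℕ}
    (hΓ : IsPackingColoring G k Γ) : Set.InjOn Γ {v | 4 ≤ Γ v} := fun u hu v _ huv => by
  by_contra hne
  have hle : ((Γ u + 1 : ℕ) : ℕ∞) ≤ (4 : ℕ) := (hΓ.2 u v hne huv).trans (hG.edist_le_four u v)
  exact (Nat.cast_le.1 hle).not_gt (Nat.lt_succ_of_le hu)

theorem IsMooreGraph.card_filter_four_le (hG : IsMooreGraph G (q + 1) 8) {k : ℕ} {Γ : V → ℕ}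
    (hΓ : IsPackingColoring G k Γ) : #{v | 4 ≤ Γ v} ≤ k - 3 := by
  refine (card_le_card_of_injOn (t := Icc 4 k) Γ (fun v hv => ?_) ?_).trans_eq (Nat.card_Icc 4 k)
  · exact mem_Icc.2 ⟨(mem_filter_univ v).1 hv, (hΓ.1 v).2⟩
  · simpa using hG.injOn_of_isPackingColoring hΓ

theorem IsMooreGraph.le_of_isPackingColoring (hG : IsMooreGraph G (q + 1) 8) (hq : 3 ≤ q) {k : ℕ}
    {Γ : V → ℕ} (hΓ : IsPackingColoring G k Γ) : (q ^ 2 + 1) * (q - 1) + 3 ≤ k := by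
  classical
  obtain ⟨hrange, hpack⟩ := isPackingColoring_iff.1 hΓ
  have hclass (i : ℕ) : IsPacking G i (({v | Γ v = i} : Finset V) : Set V) := by
    simpa using hpack i
  have h₁₂ := hG.card_add_card_le hq (hclass 1) (hclass 2)
    (disjoint_filter.2 fun v _ h₁ h₂ => by lia)
  have h₃ := hG.card_le_of_isPacking_three (hclass 3)
  have h₄ := hG.card_filter_four_le hΓ
  have htotal : Fintype.card V =
      #{v | Γ v = 1} + #{v | Γ v = 2} + #{v | Γ v = 3} + #{v | 4 ≤ Γ v} := by
    simp only [card_filter, ← sum_add_distrib, Fintype.card_eq_sum_ones]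
    refine sum_congr rfl fun v _ => ?_
    have := (hrange v).1
    split_ifs <;> lia
  rw [hG.card_eq] at htotal
  obtain ⟨m, rfl⟩ : ∃ m, q = m + 1 := ⟨q - 1, by lia⟩
  have : 0 < ((m + 1) ^ 2 + 1) * m := Nat.mul_pos (by positivity) (by lia)
  rw [Nat.add_sub_cancel]
  lia

theorem IsMooreGraph.le_packingChromaticNumber (hG : IsMooreGraph G (q + 1) 8) (hq : 3 ≤ q) :
    (q ^ 2 + 1) * (q - 1) + 3 ≤ packingChromaticNumber G :=
  let ⟨_, hΓ⟩ := exists_isPackingColoring_packingChromaticNumber G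
  hG.le_of_isPackingColoring hq hΓ

end MoorePacking

section PackingChromaticNumber

variable {V W : Type*} {G : SimpleGraph V} {H : SimpleGraph W}

theorem IsPackingColoring.packingChromaticNumber_le {k : ℕ} {Γ : V → ℕ}
    (hΓ : IsPackingColoring G k Γ) : packingChromaticNumber G ≤ k :=
  Nat.sInf_le ⟨Γ, hΓ⟩

theorem edist_le_edist_of_hom (φ : G →g H) (u v : V) : H.edist (φ u) (φ v) ≤ G.edist u v :=
  le_iInf fun p => (edist_le (p.map φ)).trans_eq (by rw [Walk.length_map])

theorem IsPackingColoring.comp_iso {k : ℕ} {Γ : W → ℕ} (hΓ : IsPackingColoring H k Γ)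
    (φ : G ≃g H) : IsPackingColoring G k (Γ ∘ φ) :=
  ⟨fun v => hΓ.1 (φ v), fun u v huv h =>
    (hΓ.2 (φ u) (φ v) (φ.injective.ne huv) h).trans (edist_le_edist_of_hom φ.toHom u v)⟩

theorem packingChromaticNumber_le_of_iso [Finite W] (φ : G ≃g H) :
    packingChromaticNumber G ≤ packingChromaticNumber H :=
  let ⟨_, hΓ⟩ := exists_isPackingColoring_packingChromaticNumber H
  (hΓ.comp_iso φ).packingChromaticNumber_le

theorem packingChromaticNumber_le_card_add {c : V → ℕ} {m : ℕ} (hc : ∀ v, c v ≤ m)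
    (hpack : ∀ i ≠ 0, IsPacking G i {v | c v = i}) [Finite {v // c v = 0}] :
    packingChromaticNumber G ≤ Nat.card {v // c v = 0} + m := by
  classical
  let e := Finite.equivFin {v // c v = 0}
  let Γ (v : V) : ℕ := if h : c v = 0 then e ⟨v, h⟩ + (m + 1) else c v
  refine IsPackingColoring.packingChromaticNumber_le (Γ := Γ)
    (isPackingColoring_iff.2 ⟨fun v => ?_, fun i u hu v hv huv => ?_⟩)
  · have := hc v
    simp only [Γ]
    split_ifs with h <;> lia
  · have := hc u
    have := hc v
    simp only [Set.mem_ofPred_eq, Γ] at hu hv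
    split_ifs at hu hv with h₁ h₂ h₂
    · have := e.injective (Fin.ext (Nat.add_right_cancel (hu.trans hv.symm)))
      exact absurd (congrArg Subtype.val this) huv
    · lia
    · lia
    · exact hpack i (hu ▸ h₁) hu hv huv

end PackingChromaticNumber

section GQ

namespace GQCoord

variable {F : Type*} [Field F] {α d x y z x' y' : F} {p p' l : GQCoord F}

theorem eq_and_eq_of_gqIncident (hα : ∀ t, t ^ 2 - t ≠ α)
    (h : GQIncident (.aff x y (α * x + y + d)) l)
    (h' : GQIncident (.aff x' y' (α * x' + y' + d)) l) : x = x' ∧ y = y' := by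
  cases l with
  | aff a b c =>
    obtain ⟨hy, hz⟩ := h
    obtain ⟨hy', hz'⟩ := h'
    have hmul : (a ^ 2 - a - α) * (x - x') = 0 := by
      linear_combination hz' - hz + (hy - hy')
    have hx : x = x' :=
      sub_eq_zero.1 ((mul_eq_zero.1 hmul).resolve_left (sub_ne_zero.2 (hα a)))
    exact ⟨hx, by rw [hy, hy', hx]⟩
  | rho₁ b c => exact ⟨h.1.trans h'.1.symm, h.2.trans h'.2.symm⟩
  | rho₂ c => exact h.elim
  | rho₃ => exact h.elim

theorem not_gqIncident_rho₃ (h : GQIncident (.aff x y z) l) : ¬GQIncident .rho₃ l := by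
  cases l <;> first | exact id | exact h.elim

/-- The affine points of the plane `z = α x + y + d` together with `(ρ, ρ, ρ)`. When `α` is not of
the form `t ^ 2 - t`, this is an ovoid of the quadrangle: no two of its points are collinear. -/
def ovoid (α d : F) : Set (GQCoord F) :=
  {p | p = .rho₃ ∨ ∃ x y, p = .aff x y (α * x + y + d)}

theorem aff_mem_ovoid : aff x y z ∈ ovoid α d ↔ z = α * x + y + d := by
  simp [ovoid]

theorem eq_of_mem_ovoid (hα : ∀ t, t ^ 2 - t ≠ α) (hp : p ∈ ovoid α d) (hp' : p' ∈ ovoid α d)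
    (h : GQIncident p l) (h' : GQIncident p' l) : p = p' := by
  obtain rfl | ⟨x, y, rfl⟩ := hp <;> obtain rfl | ⟨x', y', rfl⟩ := hp'
  · rfl
  · exact (not_gqIncident_rho₃ h' h).elim
  · exact (not_gqIncident_rho₃ h h').elim
  · obtain ⟨rfl, rfl⟩ := eq_and_eq_of_gqIncident hα h h'
    rfl

theorem isPacking_three_image_ovoid (hα : ∀ t, t ^ 2 - t ≠ α) (d : F) :
    IsPacking (gqGraph F) 3 (Sum.inl '' ovoid α d) := by
  let c : (gqGraph F).Coloring Bool := Coloring.mk Sum.isLeft fun {u v} huv => by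
    cases u <;> cases v <;> first | exact huv.elim | simp
  refine isPacking_three_of_coloring c (b := true) (by rintro _ ⟨p, -, rfl⟩; rfl) ?_
  rintro _ ⟨p, hp, rfl⟩ _ ⟨p', hp', rfl⟩ (w | l) h h'
  · exact h.elim
  · exact congrArg Sum.inl (eq_of_mem_ovoid hα hp hp' h h')

open Classical in
/-- A partial packing coloring of the quadrangle: the lines get color `1`, an ovoid gets color `2`
and another one, without their common point, gets color `3`. The vertices of color `0` are still to
be colored. -/
noncomputable def ovoidColoring (α : F) : GQCoord F ⊕ GQCoord F → ℕ
  | .inr _ => 1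
  | .inl p => if p ∈ ovoid α 0 then 2 else if p ∈ ovoid α 1 then 3 else 0

theorem ovoidColoring_le (v : GQCoord F ⊕ GQCoord F) : ovoidColoring α v ≤ 3 := by
  unfold ovoidColoring
  split <;> (try split_ifs) <;> lia

theorem ovoidColoring_inl_ne_one (p : GQCoord F) : ovoidColoring α (.inl p) ≠ 1 := by
  simp only [ovoidColoring]
  split_ifs <;> decide

theorem mem_image_ovoid_of_ovoidColoring_eq_two {v : GQCoord F ⊕ GQCoord F}
    (h : ovoidColoring α v = 2) : v ∈ Sum.inl '' ovoid α 0 := by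
  obtain p | l := v
  · exact ⟨p, by grind [ovoidColoring], rfl⟩
  · simp [ovoidColoring] at h

theorem mem_image_ovoid_of_ovoidColoring_eq_three {v : GQCoord F ⊕ GQCoord F}
    (h : ovoidColoring α v = 3) : v ∈ Sum.inl '' ovoid α 1 := by
  obtain p | l := v
  · exact ⟨p, by grind [ovoidColoring], rfl⟩
  · simp [ovoidColoring] at h

theorem isPacking_ovoidColoring (hα : ∀ t, t ^ 2 - t ≠ α) {i : ℕ} (hi : i ≠ 0) :
    IsPacking (gqGraph F) i {v | ovoidColoring α v = i} := by
  obtain rfl | rfl | rfl | hi : i = 1 ∨ i = 2 ∨ i = 3 ∨ 4 ≤ i := by lia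
  · rw [isPacking_one_iff]
    rintro (p | l) hp (p' | l') hp' _ h
    · exact h
    · exact ovoidColoring_inl_ne_one p hp
    · exact ovoidColoring_inl_ne_one p' hp'
    · exact h
  · exact ((isPacking_three_image_ovoid hα 0).of_le (by decide)).subset fun _ =>
      mem_image_ovoid_of_ovoidColoring_eq_two
  · exact (isPacking_three_image_ovoid hα 1).subset fun _ =>
      mem_image_ovoid_of_ovoidColoring_eq_three
  · exact fun v hv => absurd (ovoidColoring_le v) (by rw [Set.mem_ofPred.1 hv]; lia)

theorem exists_surjective_ovoidColoring_eq_zero (α : F) :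
    ∃ g : (F × F × ({0, 1}ᶜ : Set F)) ⊕ (F × F) ⊕ F → {v // ovoidColoring α v = 0},
      g.Surjective := by
  refine ⟨Sum.elim (fun a => ⟨.inl (.aff a.1 a.2.1 (α * a.1 + a.2.1 + a.2.2)), ?_⟩)
    (Sum.elim (fun a => ⟨.inl (.rho₁ a.1 a.2), ?_⟩) fun a => ⟨.inl (.rho₂ a), ?_⟩), ?_⟩
  · have := a.2.2.2
    rw [Set.mem_compl_iff, Set.mem_insert_iff, Set.mem_singleton_iff, not_or] at this
    simp [ovoidColoring, aff_mem_ovoid, this]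
  · simp [ovoidColoring, ovoid]
  · simp [ovoidColoring, ovoid]
  · rintro ⟨p | l, h⟩
    · cases p with
      | aff x y z =>
        refine ⟨.inl ⟨x, y, z - (α * x + y), fun hd => ?_⟩, by simp⟩
        rw [Set.mem_insert_iff, Set.mem_singleton_iff, sub_eq_iff_eq_add', sub_eq_iff_eq_add',
          ← aff_mem_ovoid, ← aff_mem_ovoid] at hd
        grind [ovoidColoring]
      | rho₁ b c => exact ⟨.inr (.inl (b, c)), rfl⟩
      | rho₂ c => exact ⟨.inr (.inr c), rfl⟩
      | rho₃ => simp [ovoidColoring, ovoid] at h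
    · contradiction

theorem card_ovoidColoring_eq_zero_le [Finite F] :
    Nat.card {v // ovoidColoring α v = 0} ≤ (Nat.card F ^ 2 + 1) * (Nat.card F - 1) + 1 := by
  obtain ⟨g, hg⟩ := exists_surjective_ovoidColoring_eq_zero α
  refine (Nat.card_le_card_of_surjective g hg).trans_eq ?_
  have hd : Nat.card ({0, 1}ᶜ : Set F) = Nat.card F - 2 := by
    rw [Nat.card_coe_set_eq, Set.ncard_compl, Set.ncard_pair zero_ne_one]
  obtain ⟨n, hn⟩ : ∃ n, Nat.card F = n + 2 := ⟨Nat.card F - 2, by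
    have := Finite.one_lt_card (α := F)
    lia⟩
  simp only [Nat.card_sum, Nat.card_prod, hd, hn, Nat.add_sub_cancel, show n + 2 - 1 = n + 1 by lia]
  ring

theorem exists_forall_sq_sub_ne [Finite F] : ∃ α : F, ∀ t, t ^ 2 - t ≠ α := by
  by_contra! hsurj
  have hinj := Finite.injective_iff_surjective.2 hsurj
  exact zero_ne_one (hinj (a₁ := (0 : F)) (a₂ := 1) (by norm_num))

theorem packingChromaticNumber_gqGraph_le [Finite F] :
    packingChromaticNumber (gqGraph F) ≤ (Nat.card F ^ 2 + 1) * (Nat.card F - 1) + 4 := by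
  obtain ⟨α, hα⟩ := exists_forall_sq_sub_ne (F := F)
  obtain ⟨g, hg⟩ := exists_surjective_ovoidColoring_eq_zero α
  have := Finite.of_surjective g hg
  calc packingChromaticNumber (gqGraph F) ≤ Nat.card {v // ovoidColoring α v = 0} + 3 :=
        packingChromaticNumber_le_card_add ovoidColoring_le fun _ => isPacking_ovoidColoring hα
    _ ≤ (Nat.card F ^ 2 + 1) * (Nat.card F - 1) + 1 + 3 :=
        Nat.add_le_add_right card_ovoidColoring_eq_zero_le 3

end GQCoord

end GQ

theorem mainTheorem2_general (q : ℕ) (hq : 3 ≤ q) {V : Type*} [Fintype V] (G : SimpleGraph V)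
    [DecidableRel G.Adj] (hG : IsMooreGraph G (q + 1) 8) :
    (q ^ 2 + 1) * (q - 1) + 3 ≤ packingChromaticNumber G ∧
      ∀ (F : Type*) [Field F] [Fintype F], Fintype.card F = q →
        Nonempty (G ≃g gqGraph F) →
          packingChromaticNumber G ≤ (q ^ 2 + 1) * (q - 1) + 4 := by
  refine ⟨hG.le_packingChromaticNumber hq, fun F _ _ hF ⟨φ⟩ => ?_⟩
  have : Finite (GQCoord F ⊕ GQCoord F) := .of_equiv V φ.toEquiv
  rw [← hF, ← Nat.card_eq_fintype_card]
  exact (packingChromaticNumber_le_of_iso φ).trans GQCoord.packingChromaticNumber_gqGraph_le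

theorem mainTheorem2 (q : ℕ) (hq : IsPrimePow q) (hodd : Odd q)
    {V : Type*} [Fintype V] (G : SimpleGraph V) [DecidableRel G.Adj]
    (hG : IsMooreGraph G (q + 1) 8) :
    (q ^ 2 + 1) * (q - 1) + 3 ≤ packingChromaticNumber G ∧
      ∀ (F : Type*) [Field F] [Fintype F], Fintype.card F = q →
        Nonempty (G ≃g gqGraph F) →
          packingChromaticNumber G ≤ (q ^ 2 + 1) * (q - 1) + 4 :=
  have hq₃ : 3 ≤ q := by grind [hq.one_lt]
  mainTheorem2_general q hq₃ G hG
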